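/- For real $\nu\ge 1$ let $J_\nu(x)=\sum_{k\ge 0}\frac{(-1)^k}{k!\,\Gamma(\nu+k+1)}\left(\frac x2\right)^{2k+\nu}$, $x\ge 0$, be the Bessel function of the first kind of order $\nu$, and put $\tilde J_\nu(x)=\sqrt{x}\,J_\nu(x)$. For an interval $I\subseteq[0,\infty)$ (bounded or unbounded), a real-valued Lebesgue measurable function $t$ on $(0,1)$ and a complex-valued $g\in L^2(I)$, let $$T_\nu^1 g(r)=\int_I e^{i\,t(r)s^2}\,\tilde J_\nu(rs)\,\chi_{[0,\nu]}(rs)\,s^{-1/4}\,g(s)\,ds,\qquad 0<r<1.$$ **Proposition 2.2.** There is a constant $C>0$ such that for all real $\nu\ge 1$, all intervals $I\subseteq[0,\infty)$, all measurable $t:(0,1)\to\mathbb{R}$ and all $g\in L^2(I)$, the integral defining $T_\nu^1 g(r)$ converges absolutely for almost every $r\in(0,1)$, the function $T_\nu^1 g$ belongs to $L^2(0,1)$, and $$\|T_\nu^1 g\|_{L^2(0,1)}\le C\,\|g\|_{L^2(I)}.$$ -/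

import Mathlib

open MeasureTheory Set

noncomputable section

/-- The Bessel function of the first kind of real order `ν`,
`J_ν(x) = (x/2)^ν ∑_{k ≥ 0} (-1)^k (x/2)^{2k} / (k! Γ(ν+k+1))`, for real `x ≥ 0`
(the only arguments at which it is used below). -/
def besselJ (ν x : ℝ) : ℝ :=
  (x / 2) ^ ν * ∑' k : ℕ, (-1) ^ k / ((k.factorial : ℝ) * Real.Gamma (ν + k + 1)) * (x / 2) ^ (2 * k)

/-- The series defining `besselJ ν x` converges (absolutely), so its `tsum` is the true sum. -/
theorem summable_besselJ_series {ν : ℝ} (hν : 1 ≤ ν) (x : ℝ) :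
    Summable fun k : ℕ =>
      (-1) ^ k / ((k.factorial : ℝ) * Real.Gamma (ν + k + 1)) * (x / 2) ^ (2 * k) := by
  refine Summable.of_norm_bounded (Real.summable_pow_div_factorial ((x / 2) ^ 2)) fun k => ?_
  have hk : (0 : ℝ) ≤ k := k.cast_nonneg
  have hG : 1 ≤ Real.Gamma (ν + k + 1) := by
    have h2 : (2 : ℝ) ≤ ν + k + 1 := by linarith
    have h := Real.Gamma_strictMonoOn_Ici.monotoneOn (mem_Ici.2 le_rfl) (mem_Ici.2 h2) h2
    rwa [Real.Gamma_two] at h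
  have hf : (0 : ℝ) < k.factorial := by exact_mod_cast k.factorial_pos
  have hp : 0 ≤ (x / 2) ^ (2 * k) := by rw [pow_mul]; positivity
  rw [Real.norm_eq_abs, abs_mul, abs_div, abs_pow, abs_neg, abs_one, one_pow, abs_of_nonneg hp,
    abs_of_pos (by positivity), ← pow_mul, div_mul_eq_mul_div, one_mul]
  exact div_le_div_of_nonneg_left hp hf (by nlinarith)

/-- `J̃_ν(x) = √x J_ν(x)` for `x ≥ 0`. -/
def besselJTilde (ν x : ℝ) : ℝ := Real.sqrt x * besselJ ν x

/-- The kernel `e^{i t(r) s²} J̃_ν(rs) χ_{[0,ν]}(rs) s^{-1/4}`. -/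
def kernelT1 (ν : ℝ) (t : ℝ → ℝ) (r s : ℝ) : ℂ :=
  Complex.exp (Complex.I * (t r : ℂ) * (s : ℂ) ^ 2) *
    (((Icc 0 ν).indicator (besselJTilde ν) (r * s) * s ^ (-(1 / 4) : ℝ) : ℝ) : ℂ)

/-- The operator `T_ν^1 g(r) = ∫_J e^{i t(r) s²} J̃_ν(rs) χ_{[0,ν]}(rs) s^{-1/4} g(s) ds`
on the interval `J`. -/
def opT1 (ν : ℝ) (J : Set ℝ) (t : ℝ → ℝ) (g : ℝ → ℂ) (r : ℝ) : ℂ :=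
  ∫ s in J, kernelT1 ν t r s * g s

end

/-! The phase has modulus one, so neither oscillation nor the choice of `t` matters. For `0 < r < 1`
one has `s^{-1/4} ≤ (rs)^{-1/4}`, and the modulus of the kernel is at most `Φ(rs) √(rs)` with `Φ(u)
= u^{-1/4} J_ν(u)` on `(0, ν]` and zero beyond. This is a multiplicative convolution, and a weighted
Cauchy–Schwarz (Schur) argument bounds its `L²` norm by `∫ Φ`
(`lintegral_sq_lintegral_comp_mul_le`). Everything rests on bounding `∫₀^ν u^{-1/4} J_ν(u) du`
uniformly in `ν` (`lintegral_rpow_mul_besselJ_le_of_pow`).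

On `[0, ν]` the function `J_ν` is nonnegative and increasing. Up to distance `ν^{1/3}/2` from the
turning point `ν`, the energy `besselE` gives `x J_ν' ≥ (ν^{2/3}/2) J_ν`, so the integral is
controlled by `∫ J_ν'`; the remaining interval is short. Both pieces are bounded once `J_ν(ν) ≲
ν^{-1/6}`, which is weaker than the true decay `ν^{-1/3}` but has an elementary proof
(`besselJ_self_le`): the sum of the squares `J_{ν+k}(ν)²` is bounded (`sum_besselJ_sq_le`), while
convexity in `k` and the logarithmic derivative bound `besselD_self_le` keep about `ν^{1/3}` of its
terms comparable to `J_ν(ν)²`.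

Writing `ν = ρ¹²` turns all the fractional exponents of `ν` in these estimates into integral powers
of `ρ`. -/

/-! ### Power series, recurrences and the Bessel equation. -/

/-- The entire function `F_a(z) = ∑ (-1)^k z^k / (k! Γ(a+k+1))`, for which
`J_a(x) = (x/2)^a F_a(x²/4)`. -/
noncomputable def besselF (a z : ℝ) : ℝ :=
  ∑' k : ℕ, (-1) ^ k / ((k.factorial : ℝ) * Real.Gamma (a + k + 1)) * z ^ k

theorem besselJ_eq (a x : ℝ) : besselJ a x = (x / 2) ^ a * besselF a ((x / 2) ^ 2) := by
  simp only [besselJ, besselF, pow_mul]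

theorem one_le_Gamma_of_two_le {y : ℝ} (hy : 2 ≤ y) : 1 ≤ Real.Gamma y := by
  have h := Real.Gamma_strictMonoOn_Ici.monotoneOn (mem_Ici.2 le_rfl) (mem_Ici.2 hy) hy
  rwa [Real.Gamma_two] at h

theorem abs_besselF_coeff_le {a : ℝ} (ha : 1 ≤ a) (k : ℕ) :
    |(-1) ^ k / ((k.factorial : ℝ) * Real.Gamma (a + k + 1))| ≤ 1 / (k.factorial : ℝ) := by
  have hk : (0 : ℝ) ≤ k := k.cast_nonneg
  have hG : 1 ≤ Real.Gamma (a + k + 1) := one_le_Gamma_of_two_le (by linarith)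
  have hf : (0 : ℝ) < k.factorial := by exact_mod_cast k.factorial_pos
  rw [abs_div, abs_pow, abs_neg, abs_one, one_pow, abs_of_pos (by positivity)]
  exact div_le_div_of_nonneg_left zero_le_one hf (by nlinarith)

theorem summable_besselF {a : ℝ} (ha : 1 ≤ a) (z : ℝ) :
    Summable fun k : ℕ => (-1) ^ k / ((k.factorial : ℝ) * Real.Gamma (a + k + 1)) * z ^ k := by
  refine Summable.of_norm_bounded (Real.summable_pow_div_factorial |z|) fun k => ?_
  rw [Real.norm_eq_abs, abs_mul, abs_pow]
  exact (mul_le_mul_of_nonneg_right (abs_besselF_coeff_le ha k) (by positivity)).trans_eq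
    (one_div_mul_eq_div _ _)

theorem hasDerivAt_besselF {a : ℝ} (ha : 1 ≤ a) (z : ℝ) :
    HasDerivAt (besselF a) (-besselF (a + 1) z) z := by
  set c : ℕ → ℝ := fun k => (-1) ^ k / ((k.factorial : ℝ) * Real.Gamma (a + k + 1)) with hc
  set R : ℝ := |z| + 1
  have hR : 0 ≤ R := by positivity
  have hu : Summable fun k : ℕ => 1 / (k.factorial : ℝ) * (k * R ^ (k - 1)) := by
    rw [← summable_nat_add_iff 1]
    refine (Real.summable_pow_div_factorial R).congr fun k => ?_
    have hf : (k.factorial : ℝ) ≠ 0 := by exact_mod_cast k.factorial_ne_zero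
    have hk : (k : ℝ) + 1 ≠ 0 := by positivity
    rw [Nat.factorial_succ, Nat.add_sub_cancel]
    push_cast
    field_simp
  have hz : z ∈ Metric.ball (0 : ℝ) R := by simp [R]
  have key := hasDerivAt_tsum_of_isPreconnected (g := fun k y => c k * y ^ k)
    (g' := fun k y => c k * (k * y ^ (k - 1))) hu Metric.isOpen_ball
    (convex_ball (0 : ℝ) R).isPreconnected
    (fun k y _ => (hasDerivAt_pow k y).const_mul (c k)) (fun k y hy => by
      have hy' : |y| ≤ R := by simpa using (Metric.mem_ball.1 hy).le
      rw [Real.norm_eq_abs, abs_mul, abs_mul, abs_pow, Nat.abs_cast]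
      gcongr
      exact abs_besselF_coeff_le ha k) hz (summable_besselF ha z) hz
  have hs : Summable fun k : ℕ => c k * (k * z ^ (k - 1)) := by
    refine Summable.of_norm_bounded hu fun k => ?_
    have hy' : |z| ≤ R := by simp [R]
    rw [Real.norm_eq_abs, abs_mul, abs_mul, abs_pow, Nat.abs_cast]
    gcongr
    exact abs_besselF_coeff_le ha k
  suffices h : -besselF (a + 1) z = ∑' k : ℕ, c k * (k * z ^ (k - 1)) by rw [h]; exact key
  rw [hs.tsum_eq_zero_add, besselF, ← tsum_neg]
  simp only [CharP.cast_eq_zero, zero_mul, mul_zero, zero_add, Nat.add_sub_cancel]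
  refine tsum_congr fun k => ?_
  have hf : (k.factorial : ℝ) ≠ 0 := by exact_mod_cast k.factorial_ne_zero
  have hk : (k : ℝ) + 1 ≠ 0 := by positivity
  have hG : Real.Gamma (a + k + 2) ≠ 0 := (Real.Gamma_pos_of_pos (by positivity)).ne'
  simp only [hc]
  rw [Nat.factorial_succ]
  push_cast
  rw [show a + 1 + (k : ℝ) + 1 = a + k + 2 by ring, show a + ((k : ℝ) + 1) + 1 = a + k + 2 by ring]
  field_simp
  ring

theorem besselF_recurrence {a : ℝ} (ha : 1 ≤ a) (z : ℝ) :
    besselF a z = (a + 1) * besselF (a + 1) z - z * besselF (a + 2) z := by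
  have h1 := summable_besselF (a := a + 1) (by linarith) z
  have h2 := summable_besselF (a := a + 2) (by linarith) z
  -- The factor `k` kills the zeroth term; shifting the index turns the rest into the series of `-z
  -- F_{a+2}(z)`.
  have e2 : Summable fun k : ℕ => (-1) ^ k / ((k.factorial : ℝ) * Real.Gamma (a + 1 + k + 1)) *
      z ^ k * k := by
    rw [← summable_nat_add_iff 1]
    refine (h2.mul_left (-z)).congr fun k => ?_
    have hf : (k.factorial : ℝ) ≠ 0 := by exact_mod_cast k.factorial_ne_zero
    have hk : (k : ℝ) + 1 ≠ 0 := by positivity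
    have hG : Real.Gamma (a + k + 3) ≠ 0 := (Real.Gamma_pos_of_pos (by positivity)).ne'
    rw [Nat.factorial_succ]
    push_cast
    rw [show a + 2 + (k : ℝ) + 1 = a + k + 3 by ring,
      show a + 1 + ((k : ℝ) + 1) + 1 = a + k + 3 by ring]
    field_simp
    ring
  have e3 : z * besselF (a + 2) z = -∑' k : ℕ,
      (-1) ^ k / ((k.factorial : ℝ) * Real.Gamma (a + 1 + k + 1)) * z ^ k * k := by
    rw [e2.tsum_eq_zero_add, besselF, ← tsum_mul_left, Nat.cast_zero, mul_zero, zero_add,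
      ← tsum_neg]
    refine tsum_congr fun k => ?_
    have hf : (k.factorial : ℝ) ≠ 0 := by exact_mod_cast k.factorial_ne_zero
    have hk : (k : ℝ) + 1 ≠ 0 := by positivity
    have hG : Real.Gamma (a + k + 3) ≠ 0 := (Real.Gamma_pos_of_pos (by positivity)).ne'
    rw [Nat.factorial_succ]
    push_cast
    rw [show a + 2 + (k : ℝ) + 1 = a + k + 3 by ring,
      show a + 1 + ((k : ℝ) + 1) + 1 = a + k + 3 by ring]
    field_simp
    ring
  rw [e3, sub_neg_eq_add, besselF, besselF, ← tsum_mul_left, ← (h1.mul_left (a + 1)).tsum_add e2]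
  refine tsum_congr fun k => ?_
  have hG : Real.Gamma (a + k + 1) ≠ 0 := (Real.Gamma_pos_of_pos (by positivity)).ne'
  have hk : a + (k : ℝ) + 1 ≠ 0 := by positivity
  have hf : (k.factorial : ℝ) ≠ 0 := by exact_mod_cast k.factorial_ne_zero
  rw [show a + 1 + (k : ℝ) + 1 = a + k + 1 + 1 by ring, Real.Gamma_add_one hk]
  field_simp
  ring

theorem besselF_zero (a : ℝ) : besselF a 0 = 1 / Real.Gamma (a + 1) := by
  rw [besselF, tsum_eq_single 0 fun k hk => by simp [hk]]
  simp

theorem continuous_besselF {a : ℝ} (ha : 1 ≤ a) : Continuous (besselF a) :=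
  continuous_iff_continuousAt.2 fun z => (hasDerivAt_besselF ha z).continuousAt

theorem continuous_besselJ {a : ℝ} (ha : 1 ≤ a) : Continuous (besselJ a) := by
  have h : besselJ a = fun x => (x / 2) ^ a * besselF a ((x / 2) ^ 2) := funext (besselJ_eq a)
  rw [h]
  exact ((continuous_id.div_const 2).rpow_const fun _ => Or.inr (by linarith)).mul
    ((continuous_besselF ha).comp (by fun_prop))

theorem besselJ_zero {a : ℝ} (ha : 1 ≤ a) : besselJ a 0 = 0 := by
  rw [besselJ_eq, zero_div, Real.zero_rpow (by linarith), zero_mul]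

/-- `a J_a(x) - x J_{a+1}(x)`, which is `x J_a'(x)`. -/
noncomputable def besselD (a x : ℝ) : ℝ := a * besselJ a x - x * besselJ (a + 1) x

theorem continuous_besselD {a : ℝ} (ha : 1 ≤ a) : Continuous (besselD a) :=
  ((continuous_besselJ ha).const_mul a).sub
    (continuous_id.mul (continuous_besselJ (by linarith : 1 ≤ a + 1)))

theorem besselD_zero {a : ℝ} (ha : 1 ≤ a) : besselD a 0 = 0 := by
  rw [besselD, besselJ_zero ha, mul_zero, zero_mul, sub_zero]

theorem hasDerivAt_besselJ {a x : ℝ} (ha : 1 ≤ a) (hx : 0 < x) :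
    HasDerivAt (besselJ a) (besselD a x / x) x := by
  have h : besselJ a = fun x => (x / 2) ^ a * besselF a ((x / 2) ^ 2) := funext (besselJ_eq a)
  have hx2 : 0 < x / 2 := by linarith
  have h0 : HasDerivAt (fun x : ℝ => x / 2) (1 / 2) x := (hasDerivAt_id x).div_const 2
  have h1 := h0.rpow_const (p := a) (Or.inl hx2.ne')
  have h2 : HasDerivAt (fun x : ℝ => besselF a ((x / 2) ^ 2))
      (-besselF (a + 1) ((x / 2) ^ 2) * (2 * (x / 2) ^ 1 * (1 / 2))) x :=
    HasDerivAt.comp (h₂ := besselF a) (h := fun x : ℝ => (x / 2) ^ 2) x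
      (hasDerivAt_besselF ha ((x / 2) ^ 2)) (h0.pow 2)
  have h3 := h1.mul h2
  rw [h]
  refine h3.congr_deriv ?_
  rw [besselD, besselJ_eq, besselJ_eq, Real.rpow_add_one hx2.ne', Real.rpow_sub_one hx2.ne']
  field_simp
  ring

theorem besselJ_recurrence {a x : ℝ} (ha : 1 ≤ a) (hx : 0 < x) :
    x * (besselJ a x + besselJ (a + 2) x) = 2 * (a + 1) * besselJ (a + 1) x := by
  have hx2 : x / 2 ≠ 0 := by positivity
  rw [besselJ_eq, besselJ_eq, besselJ_eq, besselF_recurrence ha,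
    show a + 2 = a + 1 + 1 by ring, Real.rpow_add_one hx2, Real.rpow_add_one hx2]
  ring

/-- This is Bessel's equation `x (x J_a')' = (a² - x²) J_a`, obtained from the three-term
recurrence. -/
theorem hasDerivAt_besselD {a x : ℝ} (ha : 1 ≤ a) (hx : 0 < x) :
    HasDerivAt (besselD a) ((a ^ 2 - x ^ 2) / x * besselJ a x) x := by
  have h := ((hasDerivAt_besselJ ha hx).const_mul a).sub
    ((hasDerivAt_id x).mul (hasDerivAt_besselJ (by linarith : 1 ≤ a + 1) hx))
  refine h.congr_deriv ?_
  have hr := besselJ_recurrence ha hx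
  simp only [besselD, id]
  rw [show a + 1 + 1 = a + 2 by ring]
  field_simp
  linear_combination x * hr

/-! ### Positivity and monotonicity up to the turning point. -/

theorem exists_besselJ_pos {a : ℝ} (ha : 1 ≤ a) :
    ∃ ε > 0, ∀ x, 0 < x → x < ε → 0 < besselJ a x := by
  have h0 : 0 < besselF a ((0 / 2) ^ 2) := by
    rw [zero_div, zero_pow two_ne_zero, besselF_zero]
    exact one_div_pos.2 (Real.Gamma_pos_of_pos (by linarith))
  have hc : Continuous fun x : ℝ => besselF a ((x / 2) ^ 2) :=
    (continuous_besselF ha).comp (by fun_prop)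
  obtain ⟨ε, hε, h⟩ := Metric.eventually_nhds_iff.1 ((hc.tendsto 0).eventually (lt_mem_nhds h0))
  refine ⟨ε, hε, fun x hx hxε => ?_⟩
  rw [besselJ_eq]
  exact mul_pos (Real.rpow_pos_of_pos (by linarith) a)
    (h (by rwa [dist_zero_right, Real.norm_eq_abs, abs_of_pos hx]))

theorem monotoneOn_Icc_of_hasDerivAt_nonneg {f f' : ℝ → ℝ} {u v : ℝ} (hf : ContinuousOn f (Icc u v))
    (hd : ∀ x ∈ Ioo u v, HasDerivAt f (f' x) x) (h : ∀ x ∈ Ioo u v, 0 ≤ f' x) :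
    MonotoneOn f (Icc u v) := by
  refine monotoneOn_of_deriv_nonneg (convex_Icc u v) hf (fun x hx => ?_) fun x hx => ?_
  · rw [interior_Icc] at hx
    exact (hd x hx).differentiableAt.differentiableWithinAt
  · rw [interior_Icc] at hx
    rw [(hd x hx).deriv]
    exact h x hx

theorem antitoneOn_Icc_of_hasDerivAt_nonpos {f f' : ℝ → ℝ} {u v : ℝ} (hf : ContinuousOn f (Icc u v))
    (hd : ∀ x ∈ Ioo u v, HasDerivAt f (f' x) x) (h : ∀ x ∈ Ioo u v, f' x ≤ 0) :
    AntitoneOn f (Icc u v) := by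
  have := monotoneOn_Icc_of_hasDerivAt_nonneg hf.neg (fun x hx => (hd x hx).neg)
    fun x hx => neg_nonneg.2 (h x hx)
  exact fun x hx y hy hxy => neg_le_neg_iff.1 (this hx hy hxy)

/-- By the Bessel equation the product has derivative `(D² + (a² - x²) J²)/x`, which is nonnegative
without knowing the sign of `J` or `D`. It makes `J²` increasing, hence excludes zeros in `(0, a]`.
-/
theorem besselJ_mul_besselD_nonneg {a x : ℝ} (ha : 1 ≤ a) (hx : x ∈ Icc 0 a) :
    0 ≤ besselJ a x * besselD a x := by
  have h := monotoneOn_Icc_of_hasDerivAt_nonneg (f := fun x => besselJ a x * besselD a x) (u := 0)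
    (v := a) ((continuous_besselJ ha).mul (continuous_besselD ha)).continuousOn
    (fun x hx => (hasDerivAt_besselJ ha hx.1).mul (hasDerivAt_besselD ha hx.1)) fun x hx => by
      have h1 : 0 < x := hx.1
      have h2 : 0 ≤ a ^ 2 - x ^ 2 := by nlinarith [hx.2]
      have : besselD a x / x * besselD a x + besselJ a x * ((a ^ 2 - x ^ 2) / x * besselJ a x) =
        besselD a x ^ 2 / x + (a ^ 2 - x ^ 2) / x * besselJ a x ^ 2 := by ring
      rw [this]
      positivity
  simpa [besselJ_zero ha] using h (left_mem_Icc.2 (by linarith)) hx hx.1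

theorem besselJ_nonneg {a x : ℝ} (ha : 1 ≤ a) (hx : x ∈ Icc 0 a) : 0 ≤ besselJ a x := by
  by_contra! hneg
  have hx0 : 0 < x := lt_of_le_of_ne hx.1 fun h => by
    rw [← h, besselJ_zero ha] at hneg
    exact hneg.false
  obtain ⟨ε, hε, hpos⟩ := exists_besselJ_pos ha
  have hm : 0 < min ε x := lt_min hε hx0
  set e := min ε x / 2
  have he : 0 < e := by positivity
  have he1 : e < ε := by linarith [min_le_left ε x, show e = min ε x / 2 from rfl]
  have he2 : e ≤ x := by linarith [min_le_right ε x, show e = min ε x / 2 from rfl]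
  have hJe := hpos e he he1
  -- A sign change would force a zero after `e`, where `J` is positive, against the growth of `J²`.
  obtain ⟨z, hz, hz0⟩ := intermediate_value_Icc' he2 (continuous_besselJ ha).continuousOn
    ⟨hneg.le, hJe.le⟩
  have h := monotoneOn_Icc_of_hasDerivAt_nonneg (f := fun x => besselJ a x ^ 2) (u := 0)
    (v := a) ((continuous_besselJ ha).pow 2).continuousOn
    (fun x hx => (hasDerivAt_besselJ ha hx.1).pow 2) fun y hy => by
      have h1 : 0 < y := hy.1
      have h2 := besselJ_mul_besselD_nonneg ha (Ioo_subset_Icc_self hy)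
      have : ((2 : ℕ) : ℝ) * besselJ a y ^ (2 - 1) * (besselD a y / y) =
        2 * (besselJ a y * besselD a y) / y := by norm_num; ring
      rw [this]
      positivity
  have h3 := h ⟨he.le, he2.trans hx.2⟩ ⟨he.le.trans hz.1, hz.2.trans hx.2⟩ hz.1
  simp only [hz0] at h3
  nlinarith

theorem besselD_nonneg {a x : ℝ} (ha : 1 ≤ a) (hx : x ∈ Icc 0 a) : 0 ≤ besselD a x := by
  have h := monotoneOn_Icc_of_hasDerivAt_nonneg (u := 0) (v := a) (continuous_besselD ha).continuousOn
    (fun x hx => hasDerivAt_besselD ha hx.1) fun x hx => by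
      have h1 : 0 < x := hx.1
      have h2 : 0 ≤ a ^ 2 - x ^ 2 := by nlinarith [hx.2]
      have h3 := besselJ_nonneg ha (Ioo_subset_Icc_self hx)
      positivity
  simpa [besselD_zero ha] using h (left_mem_Icc.2 (by linarith)) hx hx.1

theorem monotoneOn_besselJ {a : ℝ} (ha : 1 ≤ a) : MonotoneOn (besselJ a) (Icc 0 a) :=
  monotoneOn_Icc_of_hasDerivAt_nonneg (continuous_besselJ ha).continuousOn
    (fun _ hx => hasDerivAt_besselJ ha hx.1)
    fun _ hx => div_nonneg (besselD_nonneg ha (Ioo_subset_Icc_self hx)) hx.1.le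

/-! ### The energy and the logarithmic derivative. -/

/-- `(x J_a')² - (a² - x²) J_a²`. -/
noncomputable def besselE (a x : ℝ) : ℝ :=
  besselD a x ^ 2 - (a ^ 2 - x ^ 2) * besselJ a x ^ 2

theorem continuous_besselE {a : ℝ} (ha : 1 ≤ a) : Continuous (besselE a) :=
  ((continuous_besselD ha).pow 2).sub
    ((continuous_const.sub (continuous_id.pow 2)).mul ((continuous_besselJ ha).pow 2))

theorem besselE_zero {a : ℝ} (ha : 1 ≤ a) : besselE a 0 = 0 := by
  simp [besselE, besselJ_zero ha, besselD_zero ha]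

/-- The Bessel equation cancels every term except the one from differentiating the coefficient `a² -
x²`. -/
theorem hasDerivAt_besselE {a x : ℝ} (ha : 1 ≤ a) (hx : 0 < x) :
    HasDerivAt (besselE a) (2 * x * besselJ a x ^ 2) x := by
  have h := ((hasDerivAt_besselD ha hx).pow 2).sub
    ((((hasDerivAt_id x).pow 2).const_sub (a ^ 2)).mul ((hasDerivAt_besselJ ha hx).pow 2))
  refine h.congr_deriv ?_
  simp only [id, Pi.pow_apply]
  field_simp
  norm_num
  ring

theorem besselE_nonneg {a x : ℝ} (ha : 1 ≤ a) (hx : 0 ≤ x) : 0 ≤ besselE a x := by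
  have h := monotoneOn_Icc_of_hasDerivAt_nonneg (u := 0) (v := x) (continuous_besselE ha).continuousOn
    (fun x hx => hasDerivAt_besselE ha hx.1) fun x hx => by
      have h1 : 0 < x := hx.1
      positivity
  simpa [besselE_zero ha] using h (left_mem_Icc.2 hx) (right_mem_Icc.2 hx) hx

/-- Away from the turning point the solution grows: `x J_a' ≥ √(a² - x²) J_a`, for `a = ρ¹²`. -/
theorem mul_besselJ_le_besselD {ρ x : ℝ} (hρ : 1 ≤ ρ) (hx : 0 ≤ x) (hx' : x ≤ ρ ^ 12 - ρ ^ 4 / 2) :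
    ρ ^ 8 / 2 * besselJ (ρ ^ 12) x ≤ besselD (ρ ^ 12) x := by
  have ha : 1 ≤ ρ ^ 12 := one_le_pow₀ hρ
  have h4 : 0 < ρ ^ 4 := by positivity
  have hxa : x ∈ Icc 0 (ρ ^ 12) := ⟨hx, by linarith⟩
  have hE := besselE_nonneg ha hx
  have hJ := besselJ_nonneg ha hxa
  have hD := besselD_nonneg ha hxa
  rw [besselE] at hE
  -- Factor `a² - x² = (a - x)(a + x)`: the first factor is at least `ρ⁴/2`, the second at least
  -- `ρ¹²`.
  have hq : (ρ ^ 8 / 2) ^ 2 ≤ (ρ ^ 12) ^ 2 - x ^ 2 := by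
    have e : ρ ^ 12 = ρ ^ 4 * ρ ^ 8 := by ring
    have h12 : 0 < ρ ^ 12 := by positivity
    have : ρ ^ 4 / 2 * ρ ^ 12 ≤ (ρ ^ 12 - x) * (ρ ^ 12 + x) :=
      mul_le_mul (by linarith) (by linarith) h12.le (by linarith)
    have h16 : 0 < ρ ^ 16 := by positivity
    have e1 : (ρ ^ 8 / 2) ^ 2 = ρ ^ 16 / 4 := by ring
    have e2 : ρ ^ 4 / 2 * ρ ^ 12 = ρ ^ 16 / 2 := by ring
    nlinarith
  refine (pow_le_pow_iff_left₀ (by positivity) hD two_ne_zero).1 ?_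
  rw [mul_pow]
  nlinarith [sq_nonneg (besselJ (ρ ^ 12) x)]

/-- Logarithmic derivative at the turning point: `a J_a'(a) ≤ 2 a^{2/3} J_a(a)`, for `a = ρ¹²`. -/
theorem besselD_self_le {ρ : ℝ} (hρ : 1 ≤ ρ) :
    besselD (ρ ^ 12) (ρ ^ 12) ≤ 2 * ρ ^ 8 * besselJ (ρ ^ 12) (ρ ^ 12) := by
  set a := ρ ^ 12 with ha_def
  have ha : 1 ≤ a := one_le_pow₀ hρ
  have h4 : 0 < ρ ^ 4 := by positivity
  have h412 : ρ ^ 4 ≤ a := pow_le_pow_right₀ hρ (by norm_num)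
  set y := a - ρ ^ 4 / 2 with hy
  have hy0 : 0 ≤ y := by linarith
  have hya : y ≤ a := by linarith
  -- Left of `y`, the growth bound on `D` makes `E'` at most the derivative of `2ρ¹⁶ J²`, whence
  -- `E(y) ≤ 2ρ¹⁶ J(y)²`.
  have h1 := antitoneOn_Icc_of_hasDerivAt_nonpos
    (f := fun x => besselE a x - 2 * ρ ^ 16 * besselJ a x ^ 2) (u := 0) (v := y)
    ((continuous_besselE ha).sub (((continuous_besselJ ha).pow 2).const_mul _)).continuousOn
    (fun _ hx => (hasDerivAt_besselE ha hx.1).sub (((hasDerivAt_besselJ ha hx.1).pow 2).const_mul _))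
    fun x hx => by
      have hx0 : 0 < x := hx.1
      have hJ := besselJ_nonneg ha ⟨hx0.le, hx.2.le.trans hya⟩
      have hD := mul_besselJ_le_besselD hρ hx0.le hx.2.le
      rw [← ha_def] at hD
      have hx2 : x ^ 2 ≤ ρ ^ 24 := by
        have : x ≤ ρ ^ 12 := hx.2.le.trans hya
        calc x ^ 2 ≤ (ρ ^ 12) ^ 2 := by gcongr
          _ = ρ ^ 24 := by ring
      have key : x ^ 2 * besselJ a x ≤ 2 * ρ ^ 16 * besselD a x := by
        calc x ^ 2 * besselJ a x ≤ ρ ^ 24 * besselJ a x := by gcongr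
          _ = 2 * ρ ^ 16 * (ρ ^ 8 / 2 * besselJ a x) := by ring
          _ ≤ _ := by gcongr
      have e : 2 * x * besselJ a x ^ 2 - 2 * ρ ^ 16 *
          (((2 : ℕ) : ℝ) * besselJ a x ^ (2 - 1) * (besselD a x / x)) =
          2 * besselJ a x / x * (x ^ 2 * besselJ a x - 2 * ρ ^ 16 * besselD a x) := by
        field_simp
        norm_num
        ring
      rw [e]
      exact mul_nonpos_of_nonneg_of_nonpos (by positivity) (by linarith)
  have h1' := h1 (left_mem_Icc.2 hy0) (right_mem_Icc.2 hy0) hy0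
  simp only [besselE_zero ha, besselJ_zero ha] at h1'
  -- On `[y, a]`, of length `ρ⁴/2`, the slope of `E` is at most `2a J(a)²`, adding at most `ρ¹⁶
  -- J(a)²`. Thus `D(a)² = E(a) ≤ 3ρ¹⁶ J(a)²`, and 3 is rounded up to the square 4.
  have h2 := antitoneOn_Icc_of_hasDerivAt_nonpos
    (f := fun x => besselE a x - 2 * a * besselJ a a ^ 2 * x) (u := y) (v := a)
    ((continuous_besselE ha).sub (continuous_id.const_mul _)).continuousOn
    (fun x hx => (hasDerivAt_besselE ha (hy0.trans_lt hx.1)).sub ((hasDerivAt_id x).const_mul _))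
    fun x hx => by
      have hx0 : 0 < x := hy0.trans_lt hx.1
      have hJ := besselJ_nonneg ha ⟨hx0.le, hx.2.le⟩
      have hJ' := monotoneOn_besselJ ha ⟨hx0.le, hx.2.le⟩ ⟨by linarith, le_rfl⟩ hx.2.le
      have : 2 * x * besselJ a x ^ 2 ≤ 2 * a * besselJ a a ^ 2 := by
        have := hx.2.le
        gcongr
      linarith
  have h2' := h2 (left_mem_Icc.2 hya) (right_mem_Icc.2 hya) hya
  have hJy := besselJ_nonneg ha ⟨hy0, hya⟩
  have hJJ := monotoneOn_besselJ ha ⟨hy0, hya⟩ ⟨by linarith, le_rfl⟩ hya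
  have hJa : 0 ≤ besselJ a a := hJy.trans hJJ
  have hsq : besselJ a y ^ 2 ≤ besselJ a a ^ 2 := by gcongr
  have h16 : 0 < ρ ^ 16 := by positivity
  have hE : besselE a a = besselD a a ^ 2 := by simp [besselE]
  have ea : a * ρ ^ 4 = ρ ^ 16 := by rw [ha_def]; ring
  refine (pow_le_pow_iff_left₀ (besselD_nonneg ha ⟨by linarith, le_rfl⟩) (by positivity)
    two_ne_zero).1 ?_
  rw [← hE]
  have e3 : 2 * a * besselJ a a ^ 2 * a - 2 * a * besselJ a a ^ 2 * y =
      ρ ^ 16 * besselJ a a ^ 2 := by rw [← ea, hy]; ring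
  have e4 : (2 * ρ ^ 8 * besselJ a a) ^ 2 = 4 * (ρ ^ 16 * besselJ a a ^ 2) := by ring
  have h5 : ρ ^ 16 * besselJ a y ^ 2 ≤ ρ ^ 16 * besselJ a a ^ 2 := by gcongr
  have h6 : 0 ≤ ρ ^ 16 * besselJ a a ^ 2 := by positivity
  rw [e4]
  simp only at h2'
  linarith

/-! ### Weighted sums of squares over the order. -/

/-- `(x/2)^{-μ} J_{μ+k}(x)`. -/
noncomputable def besselReduced (μ : ℝ) (k : ℕ) (x : ℝ) : ℝ :=
  (x / 2) ^ k * besselF (μ + k) ((x / 2) ^ 2)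

/-- `(μ+k) ∏_{j<k} (2μ+j)/(j+1)`, the weights in the expansion of `(x/2)^{2μ}` in the squares
`J_{μ+k}(x)²`. -/
noncomputable def squareWeight (μ : ℝ) (k : ℕ) : ℝ :=
  (μ + k) * ∏ j ∈ Finset.range k, (2 * μ + j) / (j + 1)

theorem squareWeight_succ {μ : ℝ} (hμ : 1 ≤ μ) (k : ℕ) :
    squareWeight μ (k + 1) * ((k + 1) / (μ + k + 1)) =
      squareWeight μ k * ((2 * μ + k) / (μ + k)) := by
  have h1 : μ + (k : ℝ) ≠ 0 := by positivity
  have h2 : μ + (k : ℝ) + 1 ≠ 0 := by positivity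
  rw [squareWeight, squareWeight, Finset.prod_range_succ]
  push_cast
  rw [← add_assoc]
  field_simp

theorem squareWeight_pos {μ : ℝ} (hμ : 1 ≤ μ) (k : ℕ) : 0 < squareWeight μ k := by
  unfold squareWeight
  positivity

theorem squareWeight_mono {μ : ℝ} (hμ : 1 ≤ μ) : Monotone (squareWeight μ) := by
  refine monotone_nat_of_le_succ fun k => ?_
  rw [squareWeight, squareWeight, Finset.prod_range_succ]
  have hp : 0 < ∏ j ∈ Finset.range k, (2 * μ + j) / ((j : ℝ) + 1) := by positivity
  have h1 : 1 ≤ (2 * μ + k) / ((k : ℝ) + 1) := by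
    rw [one_le_div (by positivity)]
    linarith
  have h2 : μ + k ≤ μ + ((k + 1 : ℕ) : ℝ) := by push_cast; linarith
  exact mul_le_mul h2 (le_mul_of_one_le_right hp.le h1) hp.le (by positivity)

theorem besselJ_eq_besselReduced {μ x : ℝ} (hx : 0 < x) (k : ℕ) :
    besselJ (μ + k) x = (x / 2) ^ μ * besselReduced μ k x := by
  rw [besselJ_eq, besselReduced, Real.rpow_add_natCast (by positivity), mul_assoc]

theorem continuous_besselReduced {μ : ℝ} (hμ : 1 ≤ μ) (k : ℕ) :
    Continuous (besselReduced μ k) := by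
  have h : 1 ≤ μ + k := le_add_of_le_of_nonneg hμ k.cast_nonneg
  exact (by fun_prop : Continuous fun x : ℝ => (x / 2) ^ k).mul
    ((continuous_besselF h).comp (by fun_prop : Continuous fun x : ℝ => (x / 2) ^ 2))

theorem besselReduced_recurrence {μ x : ℝ} (hμ : 1 ≤ μ) (k : ℕ) :
    x * (besselReduced μ k x + besselReduced μ (k + 2) x) =
      2 * (μ + k + 1) * besselReduced μ (k + 1) x := by
  have h : 1 ≤ μ + k := le_add_of_le_of_nonneg hμ k.cast_nonneg
  simp only [besselReduced]
  rw [besselF_recurrence h]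
  push_cast
  simp only [← add_assoc]
  ring

theorem hasDerivAt_besselReduced {μ x : ℝ} (hμ : 1 ≤ μ) (hx : 0 < x) (k : ℕ) :
    HasDerivAt (besselReduced μ k) (k / x * besselReduced μ k x - besselReduced μ (k + 1) x) x := by
  have h : 1 ≤ μ + k := le_add_of_le_of_nonneg hμ k.cast_nonneg
  have h0 : HasDerivAt (fun x : ℝ => x / 2) (1 / 2) x := (hasDerivAt_id x).div_const 2
  have h2 : HasDerivAt (fun x : ℝ => besselF (μ + k) ((x / 2) ^ 2))
      (-besselF (μ + k + 1) ((x / 2) ^ 2) * (2 * (x / 2) ^ 1 * (1 / 2))) x :=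
    HasDerivAt.comp (h₂ := besselF (μ + k)) (h := fun x : ℝ => (x / 2) ^ 2) x
      (hasDerivAt_besselF h ((x / 2) ^ 2)) (h0.pow 2)
  refine ((h0.pow k).mul h2).congr_deriv ?_
  simp only [besselReduced]
  push_cast
  simp only [← add_assoc, Pi.pow_apply]
  rcases k with _ | k
  · simp
    ring
  · rw [Nat.add_sub_cancel]
    push_cast
    field_simp
    ring

/-- `∑_{k ≤ N} c_k ((x/2)^{-μ} J_{μ+k}(x))²`. -/
noncomputable def squareSum (μ : ℝ) (N : ℕ) (x : ℝ) : ℝ :=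
  ∑ k ∈ Finset.range (N + 1), squareWeight μ k * besselReduced μ k x ^ 2

/-- The weights are chosen so that the derivative telescopes: by the recurrence, each new term
cancels the previous remainder and leaves the next one. -/
theorem hasDerivAt_squareSum {μ x : ℝ} (hμ : 1 ≤ μ) (hx : 0 < x) (N : ℕ) :
    HasDerivAt (squareSum μ N) (-(squareWeight μ N * ((2 * μ + N) / (μ + N)) *
      (besselReduced μ N x * besselReduced μ (N + 1) x))) x := by
  have hterm : ∀ k : ℕ, HasDerivAt (fun x => squareWeight μ k * besselReduced μ k x ^ 2)
      (squareWeight μ k * (2 * besselReduced μ k x *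
        (k / x * besselReduced μ k x - besselReduced μ (k + 1) x))) x := fun k => by
    refine (((hasDerivAt_besselReduced hμ hx k).pow 2).const_mul _).congr_deriv ?_
    norm_num
  induction N with
  | zero =>
    have h := hterm 0
    have e : squareSum μ 0 = fun x => squareWeight μ 0 * besselReduced μ 0 x ^ 2 := by
      funext x
      simp [squareSum]
    rw [e]
    refine h.congr_deriv ?_
    have : μ ≠ 0 := by positivity
    push_cast
    field_simp
    ring
  | succ N ih =>
    have e : squareSum μ (N + 1) = fun x => squareSum μ N x +
        squareWeight μ (N + 1) * besselReduced μ (N + 1) x ^ 2 := by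
      funext x
      rw [squareSum, Finset.sum_range_succ, squareSum]
    rw [e]
    refine (ih.add (hterm (N + 1))).congr_deriv ?_
    rw [← squareWeight_succ hμ]
    have hr := besselReduced_recurrence (x := x) hμ N
    have h2 : μ + (N : ℝ) + 1 ≠ 0 := by positivity
    have h3 : besselReduced μ N x =
        2 * (μ + N + 1) * besselReduced μ (N + 1) x / x - besselReduced μ (N + 2) x := by
      field_simp
      linear_combination hr
    rw [h3]
    push_cast
    rw [← add_assoc]
    field_simp
    ring

theorem besselReduced_nonneg {μ x : ℝ} (hμ : 1 ≤ μ) (hx : 0 < x) (k : ℕ) (hxk : x ≤ μ + k) :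
    0 ≤ besselReduced μ k x := by
  have h : 1 ≤ μ + k := le_add_of_le_of_nonneg hμ k.cast_nonneg
  have hJ := besselJ_nonneg h ⟨hx.le, hxk⟩
  rw [besselJ_eq_besselReduced hx] at hJ
  exact nonneg_of_mul_nonneg_right hJ (Real.rpow_pos_of_pos (by positivity) μ)

/-- For arguments up to `μ + N` the telescoped remainder has a sign, so the finite sum is at most
its value at 0, where only `k = 0` survives. The full infinite expansion is never needed. -/
theorem squareSum_le {μ x : ℝ} (hμ : 1 ≤ μ) (N : ℕ) (hx : 0 ≤ x) (hxN : x ≤ μ + N) :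
    squareSum μ N x ≤ μ := by
  have h := antitoneOn_Icc_of_hasDerivAt_nonpos (f := squareSum μ N) (u := 0) (v := μ + N)
    (continuous_finsetSum _ fun k _ =>
      ((continuous_besselReduced hμ k).pow 2).const_mul _).continuousOn
    (fun y hy => hasDerivAt_squareSum hμ hy.1 N) fun y hy => by
      have h1 := besselReduced_nonneg hμ hy.1 N hy.2.le
      have h2 := besselReduced_nonneg hμ hy.1 (N + 1) (by push_cast; linarith [hy.2])
      have h3 := squareWeight_pos hμ N
      rw [neg_nonpos]
      positivity
  refine (h ⟨le_rfl, hx.trans hxN⟩ ⟨hx, hxN⟩ hx).trans ?_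
  have h0 : squareSum μ N 0 = μ * (1 / Real.Gamma (μ + 1)) ^ 2 := by
    rw [squareSum, Finset.sum_eq_single 0]
    · simp [squareWeight, besselReduced, besselF_zero]
    · intro k _ hk
      simp [besselReduced, hk]
    · simp
  have hG : 1 ≤ Real.Gamma (μ + 1) := one_le_Gamma_of_two_le (by linarith)
  have h1 : 1 / Real.Gamma (μ + 1) ≤ 1 := (div_le_one (by positivity)).2 hG
  have h2 : (1 / Real.Gamma (μ + 1)) ^ 2 ≤ 1 := pow_le_one₀ (by positivity) h1
  rw [h0]
  nlinarith

theorem rpow_div_le_prod {p : ℝ} (hp : 1 ≤ p) (n : ℕ) :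
    ((p + 1 + n) / (p + 1)) ^ p ≤ ∏ j ∈ Finset.range n, (p + 1 + j) / ((j : ℝ) + 1) := by
  induction n with
  | zero =>
    have : p + 1 ≠ 0 := by positivity
    simp [this]
  | succ n ih =>
    rw [Finset.prod_range_succ]
    have hn : (0 : ℝ) ≤ n := n.cast_nonneg
    have hA : 0 < p + 1 + n := by positivity
    have hB : 0 < p + 1 + ((n + 1 : ℕ) : ℝ) := by positivity
    have hstep : ((p + 1 + ((n + 1 : ℕ) : ℝ)) / (p + 1 + n)) ^ p ≤ (p + 1 + n) / ((n : ℝ) + 1) := by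
      -- Bernoulli is applied to the reciprocal ratio, giving the lower bound `(n+2)/(p+n+2) ≥
      -- (n+1)/(p+n+1)`.
      have hb := one_add_mul_self_le_rpow_one_add
        (s := -(1 / (p + 1 + ((n + 1 : ℕ) : ℝ)))) (by
          rw [neg_le_neg_iff, div_le_one hB]
          push_cast
          linarith) hp
      have e1 : 1 + -(1 / (p + 1 + ((n + 1 : ℕ) : ℝ))) =
          ((p + 1 + ((n + 1 : ℕ) : ℝ)) / (p + 1 + n))⁻¹ := by
        rw [inv_div]
        push_cast at hB ⊢
        field_simp
        ring
      rw [e1, Real.inv_rpow (by positivity)] at hb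
      have e2 : ((n : ℝ) + 1) / (p + 1 + n) ≤ 1 + p * -(1 / (p + 1 + ((n + 1 : ℕ) : ℝ))) := by
        have : 1 + p * -(1 / (p + 1 + ((n + 1 : ℕ) : ℝ))) =
            ((n : ℝ) + 2) / (p + 1 + ((n + 1 : ℕ) : ℝ)) := by
          push_cast at hB ⊢
          field_simp
          ring
        rw [this, div_le_div_iff₀ hA hB]
        push_cast
        nlinarith
      have h3 := e2.trans hb
      rw [← inv_div] at h3
      exact (inv_le_inv₀ (by positivity) (by positivity)).1 h3
    calc ((p + 1 + ((n + 1 : ℕ) : ℝ)) / (p + 1)) ^ p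
        = ((p + 1 + n) / (p + 1)) ^ p * ((p + 1 + ((n + 1 : ℕ) : ℝ)) / (p + 1 + n)) ^ p := by
          rw [← Real.mul_rpow (by positivity) (by positivity)]
          congr 1
          field_simp
      _ ≤ _ := mul_le_mul ih hstep (by positivity) (by positivity)

/-- `c_n ≥ μ ((μ+n)/(2μ))^{2μ}`. -/
theorem le_squareWeight {μ : ℝ} (hμ : 1 ≤ μ) (n : ℕ) :
    μ * ((μ + n) / (2 * μ)) ^ (2 * μ) ≤ squareWeight μ n := by
  have h := rpow_div_le_prod (p := 2 * μ - 1) (by linarith) n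
  rw [sub_add_cancel] at h
  have hn : (0 : ℝ) ≤ n := n.cast_nonneg
  have hq : 0 < (μ + n) / (2 * μ) := by positivity
  have e : ((μ + n) / (2 * μ)) ^ (2 * μ) =
      (μ + n) / (2 * μ) * ((μ + n) / (2 * μ)) ^ (2 * μ - 1) := by
    rw [Real.rpow_sub_one hq.ne']
    field_simp
  have hle : ((μ + n) / (2 * μ)) ^ (2 * μ - 1) ≤ ((2 * μ + n) / (2 * μ)) ^ (2 * μ - 1) := by
    gcongr <;> linarith
  rw [e, squareWeight]
  calc μ * ((μ + n) / (2 * μ) * ((μ + n) / (2 * μ)) ^ (2 * μ - 1))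
      = (μ + n) / 2 * ((μ + n) / (2 * μ)) ^ (2 * μ - 1) := by field_simp
    _ ≤ (μ + n) * ∏ j ∈ Finset.range n, (2 * μ + j) / ((j : ℝ) + 1) :=
      mul_le_mul (by linarith) (hle.trans h) (by positivity) (by positivity)

/-- The weights increase, so those from index `n` on are at least `c_n`, whose lower bound `μ
(ν/(2μ))^{2μ}` matches the factor `(ν/2)^{2μ}` up to `μ^{2μ}`. -/
theorem sum_besselJ_sq_le {ν : ℝ} (hν : 1 ≤ ν) (K : ℕ) :
    ∑ k ∈ Finset.range (K + 1), besselJ (ν + k) ν ^ 2 ≤ 16 := by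
  -- This puts the base order `μ` in `[1, 2]`: large enough for the order lemmas, and small enough
  -- that `μ^{2μ} ≤ 16`.
  set n := ⌊ν - 1⌋₊ with hn
  set μ := ν - n with hμ_def
  have hn1 : (n : ℝ) ≤ ν - 1 := Nat.floor_le (by linarith)
  have hn2 : ν - 1 < n + 1 := Nat.lt_floor_add_one _
  have hμ1 : 1 ≤ μ := by linarith
  have hμ2 : μ ≤ 2 := by linarith
  have hν0 : 0 < ν := by linarith
  have hνμ : ν = μ + n := by rw [hμ_def]; ring
  have hS := squareSum_le hμ1 (n + K) hν0.le (by
    push_cast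
    have : (0 : ℝ) ≤ K := K.cast_nonneg
    linarith)
  have hsub : ∑ k ∈ Finset.range (K + 1), squareWeight μ n * besselReduced μ (n + k) ν ^ 2 ≤
      squareSum μ (n + K) ν := by
    rw [squareSum, add_assoc n K 1, Finset.sum_range_add _ n (K + 1)]
    have h0 : 0 ≤ ∑ k ∈ Finset.range n, squareWeight μ k * besselReduced μ k ν ^ 2 :=
      Finset.sum_nonneg fun k _ => mul_nonneg (squareWeight_pos hμ1 k).le (sq_nonneg _)
    refine le_trans (Finset.sum_le_sum fun k _ => ?_) (le_add_of_nonneg_left h0)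
    gcongr
    exact squareWeight_mono hμ1 (Nat.le_add_right n k)
  rw [← Finset.mul_sum] at hsub
  set S := ∑ k ∈ Finset.range (K + 1), besselReduced μ (n + k) ν ^ 2 with hS_def
  have hS0 : 0 ≤ S := Finset.sum_nonneg fun k _ => sq_nonneg _
  have hw := le_squareWeight hμ1 n
  rw [← hνμ] at hw
  have h1 : (ν / (2 * μ)) ^ (2 * μ) * S ≤ 1 := by
    have : μ * ((ν / (2 * μ)) ^ (2 * μ) * S) ≤ μ * 1 := by
      rw [← mul_assoc, mul_one]
      exact (mul_le_mul_of_nonneg_right hw hS0).trans (hsub.trans hS)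
    exact le_of_mul_le_mul_left this (by linarith)
  have e : ∑ k ∈ Finset.range (K + 1), besselJ (ν + k) ν ^ 2 =
      μ ^ (2 * μ) * ((ν / (2 * μ)) ^ (2 * μ) * S) := by
    have e1 : ∀ k : ℕ, besselJ (ν + k) ν ^ 2 = (ν / 2) ^ (2 * μ) * besselReduced μ (n + k) ν ^ 2 := by
      intro k
      have : ν + k = μ + ((n + k : ℕ) : ℝ) := by push_cast; linarith
      rw [this, besselJ_eq_besselReduced hν0, mul_pow, ← Real.rpow_mul_natCast (by positivity),
        mul_comm μ]
      norm_num
    simp only [e1]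
    rw [← Finset.mul_sum, ← mul_assoc, ← Real.mul_rpow (by positivity) (by positivity)]
    congr 2
    field_simp
  rw [e]
  have h16 : μ ^ (2 * μ) ≤ 16 := by
    calc μ ^ (2 * μ) ≤ 2 ^ (2 * μ) := by gcongr
      _ ≤ (2 : ℝ) ^ (4 : ℝ) := Real.rpow_le_rpow_of_exponent_le (by norm_num) (by linarith)
      _ = 16 := by norm_num
  calc μ ^ (2 * μ) * ((ν / (2 * μ)) ^ (2 * μ) * S) ≤ 16 * 1 :=
      mul_le_mul h16 h1 (by positivity) (by norm_num)
    _ = 16 := by norm_num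

/-! ### Size at the turning point. -/

/-- At the turning point `J_{ν+k}(ν)` is convex in `k`. -/
theorem besselJ_sub_le {ν : ℝ} (hν : 1 ≤ ν) (k : ℕ) :
    besselJ (ν + k) ν - besselJ (ν + (k + 1 : ℕ)) ν ≤ besselD ν ν / ν := by
  have hν0 : 0 < ν := by linarith
  induction k with
  | zero =>
    rw [besselD]
    simp only [Nat.cast_zero, add_zero, zero_add, Nat.cast_one]
    field_simp
    rfl
  | succ k ih =>
    refine le_trans ?_ ih
    have hk : (0 : ℝ) ≤ k := k.cast_nonneg
    -- At argument `ν` the recurrence reads `J_{ν+k} + J_{ν+k+2} = (2(ν+k+1)/ν) J_{ν+k+1} ≥ 2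
    -- J_{ν+k+1}`; the initial slope is `J_ν'(ν)`.
    have hr := besselJ_recurrence (a := ν + k) (x := ν) (by linarith) hν0
    have hp := besselJ_nonneg (a := ν + k + 1) (x := ν) (by linarith) ⟨hν0.le, by linarith⟩
    push_cast
    rw [show ν + ((k : ℝ) + 1 + 1) = ν + k + 2 by ring, show ν + ((k : ℝ) + 1) = ν + k + 1 by ring]
    have : ν * (2 * besselJ (ν + k + 1) ν) ≤ ν * (besselJ (ν + k) ν + besselJ (ν + k + 2) ν) := by
      rw [hr]
      nlinarith
    linarith [le_of_mul_le_mul_left this hν0]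

theorem sub_le_besselJ {ν : ℝ} (hν : 1 ≤ ν) (k : ℕ) :
    besselJ ν ν - k * (besselD ν ν / ν) ≤ besselJ (ν + k) ν := by
  induction k with
  | zero => simp
  | succ k ih =>
    have := besselJ_sub_le hν k
    push_cast at this ⊢
    linarith

/-- `J_a(a) ≤ 16 a^{-1/6}`, for `a = ρ¹²`. -/
theorem besselJ_self_le {ρ : ℝ} (hρ : 1 ≤ ρ) : besselJ (ρ ^ 12) (ρ ^ 12) ≤ 16 / ρ ^ 2 := by
  set a := ρ ^ 12 with ha_def
  have ha : 1 ≤ a := one_le_pow₀ hρ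
  have hD := besselD_self_le hρ
  rw [← ha_def] at hD
  have hJ := besselJ_nonneg ha ⟨by linarith, le_rfl⟩
  have h4 : 0 < ρ ^ 4 := by positivity
  -- Each step in the order loses at most `(2/ρ⁴) J_a(a)`, so through `k = K` at least half of
  -- `J_a(a)` remains.
  set K := ⌊ρ ^ 4 / 4⌋₊
  have hK1 : (K : ℝ) ≤ ρ ^ 4 / 4 := Nat.floor_le (by positivity)
  have hK2 : ρ ^ 4 / 4 < K + 1 := Nat.lt_floor_add_one _
  have hterm : ∀ k ∈ Finset.range (K + 1), (besselJ a a / 2) ^ 2 ≤ besselJ (a + k) a ^ 2 := by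
    intro k hk
    have hkK : (k : ℝ) ≤ ρ ^ 4 / 4 :=
      le_trans (by exact_mod_cast Nat.lt_succ_iff.1 (Finset.mem_range.1 hk)) hK1
    have h1 := sub_le_besselJ ha k
    have h2 : besselD a a / a ≤ 2 / ρ ^ 4 * besselJ a a := by
      rw [div_le_iff₀ (by linarith)]
      refine hD.trans_eq ?_
      rw [ha_def]
      field_simp
    have h3 : k * (besselD a a / a) ≤ besselJ a a / 2 := by
      have hDn := besselD_nonneg ha ⟨by linarith, le_rfl⟩
      calc k * (besselD a a / a) ≤ ρ ^ 4 / 4 * (2 / ρ ^ 4 * besselJ a a) := by gcongr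
        _ = besselJ a a / 2 := by field_simp; norm_num
    have : besselJ a a / 2 ≤ besselJ (a + k) a := by linarith
    gcongr
  have hsum := (Finset.sum_le_sum hterm).trans (sum_besselJ_sq_le ha K)
  rw [Finset.sum_const, Finset.card_range, nsmul_eq_mul] at hsum
  push_cast at hsum
  have hfin : ρ ^ 4 / 4 * (besselJ a a / 2) ^ 2 ≤ 16 :=
    le_trans (by gcongr) hsum
  rw [le_div_iff₀ (by positivity)]
  refine (pow_le_pow_iff_left₀ (by positivity) (by norm_num) two_ne_zero).1 ?_
  have e : (besselJ a a * ρ ^ 2) ^ 2 = 16 * (ρ ^ 4 / 4 * (besselJ a a / 2) ^ 2) := by ring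
  rw [e]
  linarith

/-! ### The weighted integral up to the turning point. -/

theorem lintegral_besselJ_deriv {a y : ℝ} (ha : 1 ≤ a) (hy : y ∈ Icc 0 a) :
    ∫⁻ u in Ioc 0 y, ENNReal.ofReal (besselD a u / u) = ENNReal.ofReal (besselJ a y) := by
  have hd : ∀ x ∈ Ioo 0 y, HasDerivAt (besselJ a) (besselD a x / x) x :=
    fun x hx => hasDerivAt_besselJ ha hx.1
  have hi := intervalIntegral.integrableOn_deriv_of_nonneg (continuous_besselJ ha).continuousOn hd
    fun x hx => div_nonneg (besselD_nonneg ha ⟨hx.1.le, hx.2.le.trans hy.2⟩) hx.1.le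
  have hI := intervalIntegral.integral_eq_sub_of_hasDerivAt_of_le hy.1
    (continuous_besselJ ha).continuousOn hd ((intervalIntegrable_iff_integrableOn_Ioc_of_le hy.1).2 hi)
  rw [intervalIntegral.integral_of_le hy.1, besselJ_zero ha, sub_zero] at hI
  rw [← hI, ofReal_integral_eq_lintegral_ofReal hi]
  filter_upwards [ae_restrict_mem measurableSet_Ioc] with x hx
  exact div_nonneg (besselD_nonneg ha ⟨hx.1.le, hx.2.trans hy.2⟩) hx.1.le

/-- `∫₀^a u^{-1/4} J_a(u) du` is bounded uniformly in `a = ρ¹² ≥ 1`. -/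
theorem lintegral_rpow_mul_besselJ_le_of_pow {ρ : ℝ} (hρ : 1 ≤ ρ) :
    ∫⁻ u in Ioc 0 (ρ ^ 12), ENNReal.ofReal (u ^ (-(1 / 4) : ℝ) * besselJ (ρ ^ 12) u) ≤ 48 := by
  set a := ρ ^ 12 with ha_def
  have ha : 1 ≤ a := one_le_pow₀ hρ
  have hρ0 : 0 < ρ := by linarith
  have h4 : 0 < ρ ^ 4 := by positivity
  have h412 : ρ ^ 4 ≤ a := pow_le_pow_right₀ hρ (by norm_num)
  set y := a - ρ ^ 4 / 2 with hy_def
  have hy : y ∈ Icc 0 a := ⟨by linarith, by linarith⟩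
  have hJa := besselJ_self_le hρ
  rw [← ha_def] at hJa
  have hJle : ∀ u ∈ Icc 0 a, besselJ a u ≤ 16 / ρ ^ 2 := fun u hu =>
    (monotoneOn_besselJ ha hu ⟨by linarith, le_rfl⟩ hu.2).trans hJa
  -- Here `J` is dominated by `(2/ρ⁸) u J'`, and `u^{3/4} ≤ ρ⁹`; integrating `J'` leaves `2ρ J(y) ≤
  -- 32/ρ`.
  have hA : ∫⁻ u in Ioc 0 y, ENNReal.ofReal (u ^ (-(1 / 4) : ℝ) * besselJ a u) ≤
      ENNReal.ofReal 32 := by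
    calc ∫⁻ u in Ioc 0 y, ENNReal.ofReal (u ^ (-(1 / 4) : ℝ) * besselJ a u)
        ≤ ∫⁻ u in Ioc 0 y, ENNReal.ofReal (2 * ρ) * ENNReal.ofReal (besselD a u / u) := by
          refine setLIntegral_mono' measurableSet_Ioc fun u hu => ?_
          rw [← ENNReal.ofReal_mul (by positivity)]
          refine ENNReal.ofReal_le_ofReal ?_
          have hu0 : 0 < u := hu.1
          have hua : u ≤ ρ ^ 12 := hu.2.trans hy.2
          have hD := mul_besselJ_le_besselD hρ hu0.le hu.2
          rw [← ha_def] at hD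
          have hDn := besselD_nonneg ha ⟨hu0.le, hua⟩
          have hJ : besselJ a u ≤ 2 / ρ ^ 8 * besselD a u := by
            calc besselJ a u = 2 / ρ ^ 8 * (ρ ^ 8 / 2 * besselJ a u) := by field_simp
              _ ≤ _ := by gcongr
          have hpow : u ^ (-(1 / 4) : ℝ) * u ≤ ρ ^ 9 := by
            rw [← Real.rpow_add_one hu0.ne']
            calc u ^ (-(1 / 4) + 1 : ℝ) ≤ (ρ ^ 12) ^ (-(1 / 4) + 1 : ℝ) :=
                Real.rpow_le_rpow hu0.le hua (by norm_num)
              _ = ρ ^ 9 := by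
                rw [← Real.rpow_natCast, ← Real.rpow_natCast, ← Real.rpow_mul hρ0.le]
                norm_num
          calc u ^ (-(1 / 4) : ℝ) * besselJ a u
              ≤ u ^ (-(1 / 4) : ℝ) * (2 / ρ ^ 8 * besselD a u) := by gcongr
            _ = (u ^ (-(1 / 4) : ℝ) * u) * (2 / ρ ^ 8 * (besselD a u / u)) := by
              field_simp
            _ ≤ ρ ^ 9 * (2 / ρ ^ 8 * (besselD a u / u)) := by gcongr
            _ = 2 * ρ * (besselD a u / u) := by field_simp
      _ = ENNReal.ofReal (2 * ρ * besselJ a y) := by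
          rw [lintegral_const_mul' _ _ ENNReal.ofReal_ne_top, lintegral_besselJ_deriv ha hy,
            ← ENNReal.ofReal_mul (by positivity)]
      _ ≤ ENNReal.ofReal 32 := by
          refine ENNReal.ofReal_le_ofReal ?_
          calc 2 * ρ * besselJ a y ≤ 2 * ρ * (16 / ρ ^ 2) := by gcongr; exact hJle y hy
            _ = 32 / ρ := by field_simp; norm_num
            _ ≤ 32 := div_le_self (by norm_num) hρ
  have hB : ∫⁻ u in Ioc y a, ENNReal.ofReal (u ^ (-(1 / 4) : ℝ) * besselJ a u) ≤
      ENNReal.ofReal 16 := by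
    calc ∫⁻ u in Ioc y a, ENNReal.ofReal (u ^ (-(1 / 4) : ℝ) * besselJ a u)
        ≤ ∫⁻ _ in Ioc y a, ENNReal.ofReal (2 / ρ ^ 3 * (16 / ρ ^ 2)) := by
          refine setLIntegral_mono' measurableSet_Ioc fun u hu => ENNReal.ofReal_le_ofReal ?_
          -- Even `a/2 ≤ u` holds; 16 is used because its fourth root is rational.
          have hu2 : a / 16 ≤ u := by linarith [hu.1]
          have hpow : u ^ (-(1 / 4) : ℝ) ≤ 2 / ρ ^ 3 := by
            calc u ^ (-(1 / 4) : ℝ) ≤ ((ρ ^ 3 / 2) ^ 4) ^ (-(1 / 4) : ℝ) := by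
                  refine Real.rpow_le_rpow_of_nonpos (by positivity) ?_ (by norm_num)
                  refine le_trans (le_of_eq ?_) hu2
                  rw [ha_def]
                  ring
              _ = 2 / ρ ^ 3 := by
                rw [← Real.rpow_natCast, ← Real.rpow_mul (by positivity)]
                norm_num
                rw [Real.rpow_neg_one, inv_div]
          have hua : u ∈ Icc 0 a := ⟨by linarith, hu.2⟩
          exact mul_le_mul hpow (hJle u hua) (besselJ_nonneg ha hua) (by positivity)
      _ = ENNReal.ofReal (2 / ρ ^ 3 * (16 / ρ ^ 2) * (ρ ^ 4 / 2)) := by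
          rw [setLIntegral_const, Real.volume_Ioc, ← ENNReal.ofReal_mul (by positivity), hy_def,
            sub_sub_cancel]
      _ ≤ ENNReal.ofReal 16 := by
          refine ENNReal.ofReal_le_ofReal ?_
          calc 2 / ρ ^ 3 * (16 / ρ ^ 2) * (ρ ^ 4 / 2) = 16 / ρ := by field_simp
            _ ≤ 16 := div_le_self (by norm_num) hρ
  calc ∫⁻ u in Ioc 0 a, ENNReal.ofReal (u ^ (-(1 / 4) : ℝ) * besselJ a u)
      ≤ ENNReal.ofReal 32 + ENNReal.ofReal 16 := by
        rw [← Ioc_union_Ioc_eq_Ioc hy.1 hy.2]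
        exact (lintegral_union_le _ _ _).trans (add_le_add hA hB)
    _ = 48 := by
        rw [← ENNReal.ofReal_add (by norm_num) (by norm_num)]
        norm_num

theorem lintegral_rpow_mul_besselJ_le {ν : ℝ} (hν : 1 ≤ ν) :
    ∫⁻ u in Ioc 0 ν, ENNReal.ofReal (u ^ (-(1 / 4) : ℝ) * besselJ ν u) ≤ 48 := by
  have h : (ν ^ (1 / 12 : ℝ)) ^ 12 = ν := by
    rw [← Real.rpow_mul_natCast (by linarith)]
    norm_num
  have := lintegral_rpow_mul_besselJ_le_of_pow (Real.one_le_rpow hν (by norm_num : (0 : ℝ) ≤ 1 / 12))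
  rwa [h] at this

/-! ### Multiplicative convolution on `L²`. -/

theorem lintegral_Ioi_comp_mul_left {Φ : ℝ → ENNReal} {r : ℝ} (hr : 0 < r) :
    ENNReal.ofReal r * ∫⁻ s in Ioi 0, Φ (r * s) = ∫⁻ u in Ioi 0, Φ u := by
  have hemb : MeasurableEmbedding fun x : ℝ => r * x :=
    (Homeomorph.mulLeft₀ r hr.ne').measurableEmbedding
  have hpre : (fun x : ℝ => r * x) ⁻¹' Ioi 0 = Ioi 0 := by
    ext x
    simp [hr]
  conv_rhs => rw [← Real.smul_map_volume_mul_left hr.ne']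
  rw [abs_of_pos hr, Measure.restrict_smul, lintegral_smul_measure, hemb.restrict_map, hpre,
    hemb.lintegral_map, smul_eq_mul]

/-- Cauchy–Schwarz after splitting `K = K^{1/2} · K^{1/2}`. -/
theorem sq_lintegral_mul_le {α : Type*} [MeasurableSpace α] {μ : Measure α} {K h : α → ENNReal}
    (hK : AEMeasurable K μ) (hh : AEMeasurable h μ) :
    (∫⁻ x, K x * h x ∂μ) ^ 2 ≤ (∫⁻ x, K x ∂μ) * ∫⁻ x, K x * h x ^ 2 ∂μ := by
  have hH := ENNReal.lintegral_mul_le_Lp_mul_Lq μ Real.HolderConjugate.two_two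
    (f := fun x => K x ^ (1 / 2 : ℝ)) (g := fun x => K x ^ (1 / 2 : ℝ) * h x)
    (hK.pow_const _) ((hK.pow_const _).mul hh)
  have e1 : ∀ y : ENNReal, (y ^ (1 / 2 : ℝ)) ^ (2 : ℝ) = y := fun y => by
    rw [← ENNReal.rpow_mul]
    norm_num
  have e2 : ∀ y : ENNReal, (y ^ (1 / 2 : ℝ)) ^ 2 = y := fun y => by
    rw [← ENNReal.rpow_two, e1]
  have e3 : ∀ x, K x ^ (1 / 2 : ℝ) * (K x ^ (1 / 2 : ℝ) * h x) = K x * h x := fun x => by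
    rw [← mul_assoc, ← sq, e2]
  have e4 : ∀ x, (K x ^ (1 / 2 : ℝ) * h x) ^ (2 : ℝ) = K x * h x ^ 2 := fun x => by
    rw [ENNReal.rpow_two, mul_pow, e2]
  simp only [Pi.mul_apply, e1, e3, e4] at hH
  calc (∫⁻ x, K x * h x ∂μ) ^ 2 ≤ _ := pow_le_pow_left₀ zero_le hH 2
    _ = _ := by rw [mul_pow, e2, e2]

/-- `L²` bound for multiplicative convolution with an integrable kernel. -/
theorem lintegral_sq_lintegral_comp_mul_le {Φ : ℝ → ENNReal} (hΦ : Measurable Φ) {B : ENNReal}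
    (hB : ∫⁻ u in Ioi 0, Φ u ≤ B) (hBtop : B ≠ ⊤) {J : Set ℝ} (hJ : J ⊆ Ici 0)
    (hJm : MeasurableSet J) {G : ℝ → ENNReal} (hG : AEMeasurable G (volume.restrict J)) :
    ∫⁻ r in Ioi 0, (∫⁻ s in J, Φ (r * s) * (ENNReal.ofReal (√r * √s) * G s)) ^ 2 ≤
      B ^ 2 * ∫⁻ s in J, G s ^ 2 := by
  -- The factor `r` in `(√r √s)²` is exactly the Jacobian normalizing `∫ Φ(rs) ds` to at most `B`;
  -- the factor `s` left over serves the `r`-integral in the same way after Tonelli.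
  have hpt : ∀ r ∈ Ioi (0 : ℝ), (∫⁻ s in J, Φ (r * s) * (ENNReal.ofReal (√r * √s) * G s)) ^ 2 ≤
      B * ∫⁻ s in J, ENNReal.ofReal s * G s ^ 2 * Φ (r * s) := by
    intro r hr
    have hr0 : 0 < r := hr
    have hΦr : Measurable fun s => Φ (r * s) := hΦ.comp (measurable_const_mul r)
    have hsq : ∀ s ∈ J, Φ (r * s) * (ENNReal.ofReal (√r * √s) * G s) ^ 2 =
        ENNReal.ofReal r * (ENNReal.ofReal s * G s ^ 2 * Φ (r * s)) := fun s hs => by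
      have hs0 : 0 ≤ s := hJ hs
      rw [mul_pow, ← ENNReal.ofReal_pow (by positivity), mul_pow, Real.sq_sqrt hr0.le,
        Real.sq_sqrt hs0, ENNReal.ofReal_mul hr0.le]
      ring
    refine (sq_lintegral_mul_le (h := fun s => ENNReal.ofReal (√r * √s) * G s) hΦr.aemeasurable
      ((by fun_prop : Measurable fun s => ENNReal.ofReal (√r * √s)).aemeasurable.mul hG)).trans ?_
    rw [setLIntegral_congr_fun hJm hsq, lintegral_const_mul' _ _ ENNReal.ofReal_ne_top, ← mul_assoc]
    gcongr
    rw [mul_comm]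
    calc ENNReal.ofReal r * ∫⁻ s in J, Φ (r * s)
        ≤ ENNReal.ofReal r * ∫⁻ s in Ici 0, Φ (r * s) := by
          gcongr
      _ = ∫⁻ u in Ioi 0, Φ u := by
          rw [setLIntegral_congr Ioi_ae_eq_Ici.symm, lintegral_Ioi_comp_mul_left hr0]
      _ ≤ B := hB
  have hmeas : AEMeasurable (Function.uncurry fun r s => ENNReal.ofReal s * G s ^ 2 * Φ (r * s))
      ((volume.restrict (Ioi 0)).prod (volume.restrict J)) := by
    refine AEMeasurable.mul (AEMeasurable.mul ?_ ?_) ?_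
    · exact (ENNReal.measurable_ofReal.comp measurable_snd).aemeasurable
    · exact (hG.pow_const 2).comp_snd
    · exact (hΦ.comp (measurable_fst.mul measurable_snd)).aemeasurable
  calc ∫⁻ r in Ioi 0, (∫⁻ s in J, Φ (r * s) * (ENNReal.ofReal (√r * √s) * G s)) ^ 2
      ≤ ∫⁻ r in Ioi 0, B * ∫⁻ s in J, ENNReal.ofReal s * G s ^ 2 * Φ (r * s) :=
        setLIntegral_mono' measurableSet_Ioi hpt
    _ = B * ∫⁻ s in J, ∫⁻ r in Ioi 0, ENNReal.ofReal s * G s ^ 2 * Φ (r * s) := by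
        rw [lintegral_const_mul' _ _ hBtop, lintegral_lintegral_swap hmeas]
    _ ≤ B * ∫⁻ s in J, B * G s ^ 2 := by
        refine mul_le_mul_right (setLIntegral_mono' hJm fun s hs => ?_) B
        have hs0 : 0 ≤ s := hJ hs
        have hΦs : Measurable fun r => Φ (r * s) := hΦ.comp (measurable_mul_const s)
        rw [lintegral_const_mul _ hΦs, mul_right_comm]
        gcongr
        rcases hs0.eq_or_lt with rfl | hs0
        · simp
        · simp only [mul_comm _ s]
          rw [lintegral_Ioi_comp_mul_left hs0]
          exact hB
    _ = B ^ 2 * ∫⁻ s in J, G s ^ 2 := by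
        rw [lintegral_const_mul' _ _ hBtop, ← mul_assoc, sq]

/-! ### The Bessel kernel and the conclusion. -/

/-- The modulus of the truncated profile, weighted so as to be a multiplicative-convolution
kernel. -/
noncomputable def besselKernel (ν u : ℝ) : ENNReal :=
  ENNReal.ofReal (|(Icc 0 ν).indicator (besselJTilde ν) u| * u ^ (-(3 / 4) : ℝ))

theorem measurable_indicator_besselJTilde {ν : ℝ} (hν : 1 ≤ ν) :
    Measurable ((Icc 0 ν).indicator (besselJTilde ν)) :=
  (Real.continuous_sqrt.mul (continuous_besselJ hν)).measurable.indicator measurableSet_Icc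

theorem measurable_besselKernel {ν : ℝ} (hν : 1 ≤ ν) : Measurable (besselKernel ν) := by
  have h := measurable_indicator_besselJTilde hν
  exact ((continuous_abs.measurable.comp h).mul (measurable_id.pow_const _)).ennreal_ofReal

theorem lintegral_besselKernel_le {ν : ℝ} (hν : 1 ≤ ν) :
    ∫⁻ u in Ioi 0, besselKernel ν u ≤ 48 := by
  have h : ∀ u ∈ Ioi (0 : ℝ), besselKernel ν u = (Ioc 0 ν).indicator
      (fun u => ENNReal.ofReal (u ^ (-(1 / 4) : ℝ) * besselJ ν u)) u := by
    intro u hu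
    have hu0 : 0 < u := hu
    by_cases huν : u ≤ ν
    · rw [besselKernel, indicator_of_mem (show u ∈ Icc 0 ν from ⟨hu0.le, huν⟩),
        indicator_of_mem (show u ∈ Ioc 0 ν from ⟨hu0, huν⟩), besselJTilde,
        abs_of_nonneg (mul_nonneg (Real.sqrt_nonneg u) (besselJ_nonneg hν ⟨hu0.le, huν⟩)),
        Real.sqrt_eq_rpow, mul_right_comm, ← Real.rpow_add hu0]
      norm_num
    · rw [besselKernel, indicator_of_notMem fun h => huν h.2, indicator_of_notMem fun h => huν h.2]
      simp
  rw [setLIntegral_congr_fun measurableSet_Ioi h]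
  refine (setLIntegral_le_lintegral _ _).trans ?_
  rw [lintegral_indicator measurableSet_Ioc]
  exact lintegral_rpow_mul_besselJ_le hν

theorem norm_kernelT1 (ν : ℝ) (t : ℝ → ℝ) (r : ℝ) {s : ℝ} (hs : 0 ≤ s) :
    ‖kernelT1 ν t r s‖ =
      |(Icc 0 ν).indicator (besselJTilde ν) (r * s)| * s ^ (-(1 / 4) : ℝ) := by
  have e : Complex.I * (t r : ℂ) * (s : ℂ) ^ 2 = Complex.I * ((t r * s ^ 2 : ℝ) : ℂ) := by
    push_cast
    ring
  rw [kernelT1, norm_mul, e, Complex.norm_exp_I_mul_ofReal, one_mul, Complex.norm_real,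
    Real.norm_eq_abs, abs_mul, abs_of_nonneg (Real.rpow_nonneg hs _)]

/-- The restriction `r < 1` enters here: the weight `s^{-1/4}` may be replaced by the larger
`(rs)^{-1/4}`, making the majorant a function of `rs` alone. -/
theorem enorm_kernelT1_le (ν : ℝ) (t : ℝ → ℝ) {r s : ℝ} (hr : r ∈ Ioo (0 : ℝ) 1) (hs : 0 < s) :
    ‖kernelT1 ν t r s‖ₑ ≤ besselKernel ν (r * s) * ENNReal.ofReal (√r * √s) := by
  have hr0 : 0 < r := hr.1
  rw [besselKernel, ← ENNReal.ofReal_mul (by positivity), ← ofReal_norm,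
    norm_kernelT1 ν t r hs.le, mul_assoc]
  refine ENNReal.ofReal_le_ofReal ?_
  gcongr
  have e : (r * s) ^ (-(3 / 4) : ℝ) * (√r * √s) = (r * s) ^ (-(1 / 4) : ℝ) := by
    rw [← Real.sqrt_mul hr0.le, Real.sqrt_eq_rpow, ← Real.rpow_add (by positivity)]
    norm_num
  rw [e]
  exact Real.rpow_le_rpow_of_nonpos (by positivity) (mul_le_of_le_one_left hs.le hr.2.le)
    (by norm_num)

theorem aestronglyMeasurable_kernelT1_mul {ν : ℝ} (hν : 1 ≤ ν) {J : Set ℝ} {t : ℝ → ℝ}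
    (ht : AEMeasurable t (volume.restrict (Ioo 0 1))) {g : ℝ → ℂ}
    (hg : AEStronglyMeasurable g (volume.restrict J)) :
    AEStronglyMeasurable (fun p : ℝ × ℝ => kernelT1 ν t p.1 p.2 * g p.2)
      ((volume.restrict (Ioo 0 1)).prod (volume.restrict J)) := by
  have ht' : AEMeasurable (fun p : ℝ × ℝ => t p.1)
      ((volume.restrict (Ioo 0 1)).prod (volume.restrict J)) := ht.comp_fst
  refine AEStronglyMeasurable.mul (AEMeasurable.aestronglyMeasurable ?_) hg.comp_snd
  refine AEMeasurable.mul ?_ ?_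
  · refine Complex.measurable_exp.comp_aemeasurable ?_
    exact ((Complex.measurable_ofReal.comp_aemeasurable ht').const_mul _).mul
      ((Complex.measurable_ofReal.comp measurable_snd).pow_const 2).aemeasurable
  · exact (Complex.measurable_ofReal.comp
      (((measurable_indicator_besselJTilde hν).comp (measurable_fst.mul measurable_snd)).mul
        (measurable_snd.pow_const _))).aemeasurable

theorem eLpNorm_two_sq {α E : Type*} [MeasurableSpace α] [NormedAddCommGroup E] (μ : Measure α)
    (f : α → E) : eLpNorm f 2 μ ^ 2 = ∫⁻ x, ‖f x‖ₑ ^ 2 ∂μ := by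
  rw [eLpNorm_eq_lintegral_rpow_enorm_toReal two_ne_zero ENNReal.ofNat_ne_top,
    ← ENNReal.rpow_two, ← ENNReal.rpow_mul]
  simp

theorem lintegral_sq_enorm_kernelT1_le {ν : ℝ} (hν : 1 ≤ ν) {J : Set ℝ} (hJ : J ⊆ Ici 0)
    (hJm : MeasurableSet J) (t : ℝ → ℝ) {g : ℝ → ℂ}
    (hg : AEStronglyMeasurable g (volume.restrict J)) :
    ∫⁻ r in Ioo 0 1, (∫⁻ s in J, ‖kernelT1 ν t r s * g s‖ₑ) ^ 2 ≤
      (48 * eLpNorm g 2 (volume.restrict J)) ^ 2 := by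
  rw [mul_pow, eLpNorm_two_sq]
  refine le_trans ?_ (lintegral_sq_lintegral_comp_mul_le (measurable_besselKernel hν)
    (lintegral_besselKernel_le hν) (by norm_num) hJ hJm hg.enorm)
  refine (setLIntegral_mono' measurableSet_Ioo fun r hr => ?_).trans
    (lintegral_mono_set Ioo_subset_Ioi_self)
  refine pow_le_pow_left₀ zero_le (lintegral_mono_ae ?_) 2
  filter_upwards [ae_restrict_mem hJm, Measure.ae_ne (volume.restrict J) 0] with s hs hs0
  have hs' : 0 < s := lt_of_le_of_ne (hJ hs) (Ne.symm hs0)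
  rw [enorm_mul, ← mul_assoc]
  gcongr
  exact enorm_kernelT1_le ν t hr hs'

/-- Intervals are the order-connected subsets of the half-line `[0, ∞)`, with or without their
endpoints, bounded or not. -/
theorem proposition2p2 :
    ∃ C : ℝ, 0 < C ∧
      ∀ ν : ℝ, 1 ≤ ν →
      ∀ J : Set ℝ, J.OrdConnected → J ⊆ Ici 0 →
      ∀ t : ℝ → ℝ, AEMeasurable t (volume.restrict (Ioo 0 1)) →
      ∀ g : ℝ → ℂ, MemLp g 2 (volume.restrict J) →
        (∀ᵐ r ∂(volume.restrict (Ioo (0 : ℝ) 1)),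
          IntegrableOn (fun s => kernelT1 ν t r s * g s) J volume) ∧
        MemLp (opT1 ν J t g) 2 (volume.restrict (Ioo 0 1)) ∧
        eLpNorm (opT1 ν J t g) 2 (volume.restrict (Ioo 0 1)) ≤
          ENNReal.ofReal C * eLpNorm g 2 (volume.restrict J) := by
  refine ⟨48, by norm_num, fun ν hν J hJo hJ t ht g hg => ?_⟩
  have hJm : MeasurableSet J := hJo.measurableSet
  have hmeas := aestronglyMeasurable_kernelT1_mul hν ht hg.aestronglyMeasurable
  have hbound := lintegral_sq_enorm_kernelT1_le hν hJ hJm t hg.aestronglyMeasurable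
  have hfin : 48 * eLpNorm g 2 (volume.restrict J) < ⊤ :=
    ENNReal.mul_lt_top (by norm_num) hg.eLpNorm_lt_top
  have hnorm : eLpNorm (opT1 ν J t g) 2 (volume.restrict (Ioo 0 1)) ≤
      48 * eLpNorm g 2 (volume.restrict J) := by
    refine (ENNReal.pow_le_pow_left_iff two_ne_zero).1 ?_
    rw [eLpNorm_two_sq]
    refine le_trans (lintegral_mono fun r => ?_) hbound
    exact pow_le_pow_left₀ zero_le (enorm_integral_le_lintegral_enorm _) 2
  refine ⟨?_, ⟨hmeas.integral_prod_right', hnorm.trans_lt hfin⟩, ?_⟩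
  -- The `L²` bound was proved for the integral of the modulus, so that integral is finite for
  -- almost every `r`, which is absolute convergence.
  · have hm : AEMeasurable (fun r => (∫⁻ s in J, ‖kernelT1 ν t r s * g s‖ₑ) ^ 2)
        (volume.restrict (Ioo 0 1)) := hmeas.enorm.lintegral_prod_right'.pow_const 2
    filter_upwards [ae_lt_top' hm (hbound.trans_lt (ENNReal.pow_lt_top hfin)).ne,
      hmeas.prodMk_left] with r hr hr'
    refine ⟨hr', ?_⟩
    rw [hasFiniteIntegral_iff_enorm]
    exact (ENNReal.pow_lt_top_iff.1 hr).resolve_right two_ne_zero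
  · simpa using hnorm
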